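/- **Theorem (Independent Jeffreys priors).** Consider the autoregressive cokriging model with $s$ levels of code. Let $\mathcal X\subset\mathbb R^d$ be compact, let $\mathcal X_s\subseteq\dots\subseteq\mathcal X_1\subseteq\mathcal X$ be finite nested designs, $n_t=|\mathcal X_t|$, and let $\mathbf y_t\in\mathbb R^{n_t}$ be the outputs of level $t$ at the inputs in $\mathcal X_t$. For $\boldsymbol\phi\in(0,\infty)^d$ let $r(\cdot,\cdot\mid\boldsymbol\phi)$ be a correlation function on $\mathcal X$, and let $\mathbf R_t=\mathbf R_t(\boldsymbol\phi_t)=r(\mathcal X_t,\mathcal X_t\mid\boldsymbol\phi_t)$. Let $\mathbf h_t$ be vectors of fixed basis functions, $\mathbf H_t=\mathbf h_t(\mathcal X_t)$, $\mathbf X_1=\mathbf H_1$, and $\mathbf X_t=[\mathbf H_t,\,y_{t-1}(\mathcal X_t)]$ for $t>1$, where $y_{t-1}(\mathcal X_t)$ is the vector of the outputs of level $t-1$ at the inputs in $\mathcal X_t$; let $q_t$ be the number of columns of $\mathbf X_t$. Put $\mathbf b_1=\boldsymbol\beta_1$, $\mathbf b_t=(\boldsymbol\beta_t,\gamma_{t-1})$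 for $t>1$, and $\boldsymbol\theta_t=(\mathbf b_t,\sigma_t^2,\boldsymbol\phi_t)\in\mathbb R^{q_t}\times(0,\infty)\times(0,\infty)^d$. The likelihood of $\boldsymbol\theta=(\boldsymbol\theta_1,\dots,\boldsymbol\theta_s)$ is $$L(\mathbf y\mid\boldsymbol\theta)=\prod_{t=1}^s\mathcal N(\mathbf y_t\mid\mathbf X_t\mathbf b_t,\ \sigma_t^2\mathbf R_t(\boldsymbol\phi_t)),$$ the $t$-th factor being the conditional density of $\mathbf y_t$ given $\mathbf y_{t-1}$. Assume that for every $t$ the matrix $\mathbf R_t(\boldsymbol\phi_t)$ is nonsingular for all $\boldsymbol\phi_t\in(0,\infty)^d$, that its entries have partial derivatives in $\phi_{t,1},\dots,\phi_{t,d}$ on $(0,\infty)^d$, and that $\mathbf X_t$ has full column rank. The Fisher information matrix of $\boldsymbol\theta_t$, all other parameters being fixed, has as its entries the expectations of the products of the partial derivatives of $\log L$ with respect to the coordinates of $\boldsymbol\theta_t$, under the conditional sampling distribution of $\mathbf y_t$ given the outputs of the lower levels (so that $\mathbf X_t$ is fixed). The Jeffreys-rule prior of a block of coordinates of $\boldsymbol\theta_t$,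 all other parameters being fixed, is proportional to the square root of the determinant of the corresponding diagonal block of this matrix. * A function $\pi^{J1}$ of $\boldsymbol\theta$ is an independent Jeffreys prior of the first kind if it is proportional to $\prod_t f_t(\mathbf b_t)\,g_t(\sigma_t^2,\boldsymbol\phi_t)$, where $f_t$ and $g_t$ are Jeffreys-rule priors of $\mathbf b_t$ and of $(\sigma_t^2,\boldsymbol\phi_t)$, respectively, for all values of the other parameters. * A function $\pi^{J2}$ of $\boldsymbol\theta$ is an independent Jeffreys prior of the second kind if it is proportional to $\prod_t f_t(\boldsymbol\theta_t)$, where $f_t$ is a Jeffreys-rule prior of the whole of $\boldsymbol\theta_t$, for all values of the parameters of the other levels. (Proportionality always means up to a positive constant, on the parameter space.) Let $\dot{\mathbf R}_t^k=\partial\mathbf R_t/\partial\phi_{t,k}$ (element-wise), let $\mathbf U_{t,k}=\dot{\mathbf R}_t^k\mathbf R_t^{-1}$, and let $I_t^J(\boldsymbol\phi_t)$ be the symmetric $(d+1)\times(d+1)$ matrix $$I_t^J(\boldsymbol\phi_t)=\begin{pmatrix} n_t & \operatorname{tr}(\mathbf U_{t,1}) & \cdots & \operatorname{tr}(\mathbf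 U_{t,d})\\ & \operatorname{tr}(\mathbf U_{t,1}^2) & \cdots & \operatorname{tr}(\mathbf U_{t,1}\mathbf U_{t,d})\\ & & \ddots & \vdots\\ & & & \operatorname{tr}(\mathbf U_{t,d}^2)\end{pmatrix}.$$ Then all these Fisher information matrices are well defined (the partial derivatives exist and the products of scores are integrable), and the independent Jeffreys priors of the two kinds are exactly the functions of the form $$\pi(\boldsymbol\beta,\boldsymbol\gamma,\boldsymbol\sigma^2,\boldsymbol\phi)\ \propto\ \frac{\pi(\boldsymbol\phi)}{\prod_{t=1}^s(\sigma_t^2)^{a_t}}$$ with, for the first kind, $$a_t=1,\qquad \pi^{J1}(\boldsymbol\phi)\ \propto\ \prod_{t=1}^s|I_t^J(\boldsymbol\phi_t)|^{1/2},$$ and, for the second kind, $$a_t=1+\frac{q_t}{2},\qquad \pi^{J2}(\boldsymbol\phi)\ \propto\ \prod_{t=1}^s|I_t^J(\boldsymbol\phi_t)|^{1/2}\ \prod_{t=1}^s|\mathbf X_t^\top\mathbf R_t^{-1}\mathbf X_t|^{1/2}.$$ -/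

import Mathlib

noncomputable section

/-- Inputs are points of `ℝ^d`; only the topology of `ℝ^d` is used. -/
abbrev Input (d : ℕ) : Type := Fin d → ℝ

/-- The set of range-parameter vectors `φ_t ∈ (0, ∞)^d`. -/
def positiveRange (d : ℕ) : Set (Fin d → ℝ) := {φ | ∀ k, 0 < φ k}

/-- `ρ` is a correlation function on `S`: it is `1` on the diagonal, and all its Gram matrices at
finitely many points of `S` are symmetric positive semidefinite. -/
def IsCorrelationFunctionOn {d : ℕ} (S : Set (Input d)) (ρ : Input d → Input d → ℝ) : Prop :=
  (∀ x ∈ S, ρ x x = 1) ∧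
    ∀ F : Finset (Input d), (F : Set (Input d)) ⊆ S →
      (Matrix.of fun x x' : {x // x ∈ F} => ρ x x').PosSemidef

/-- `f ∝ g` on `S`, with a positive constant of proportionality. -/
def ProportionalOn {α : Type*} (S : Set α) (f g : α → ℝ) : Prop :=
  ∃ c : ℝ, 0 < c ∧ ∀ x ∈ S, f x = c * g x

/-- The density of `𝒩(m, C)` on `ℝ^ι` with respect to Lebesgue measure. -/
def normalDensity {ι : Type*} [Fintype ι] [DecidableEq ι] (m : ι → ℝ) (C : Matrix ι ι ℝ)
    (z : ι → ℝ) : ℝ :=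
  (Real.sqrt ((2 * Real.pi) ^ Fintype.card ι * C.det))⁻¹ *
    Real.exp (-((z - m) ⬝ᵥ (C⁻¹.mulVec (z - m))) / 2)

/-- The autoregressive cokriging model with `s` levels of code (numbered `0, …, s - 1`, in order of
increasing accuracy) and inputs in a compact subset of `ℝ^d`. -/
structure CokrigingModel (d s : ℕ) where
  /-- The input space. -/
  inputSpace : Set (Input d)
  isCompact_inputSpace : IsCompact inputSpace
  /-- The set of inputs at which the code of level `t` is run. -/
  design : Fin s → Finset (Input d)
  design_subset : ∀ t, (design t : Set (Input d)) ⊆ inputSpace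
  /-- The design is hierarchically nested. -/
  nested : Antitone design
  /-- The number of basis functions at each level. -/
  p : Fin s → ℕ
  /-- The vector of basis functions at each level. -/
  h : ∀ t, Input d → Fin (p t) → ℝ
  /-- `r x x' φ` is the correlation of the inputs `x`, `x'` for the range parameters `φ`. -/
  r : Input d → Input d → (Fin d → ℝ) → ℝ
  isCorrelation : ∀ φ ∈ positiveRange d,
    IsCorrelationFunctionOn inputSpace (fun x x' => r x x' φ)

namespace CokrigingModel

variable {d s : ℕ} (M : CokrigingModel d s)

/-- The index set of the runs of the code of level `t`. -/
abbrev Run (t : Fin s) : Type := {x // x ∈ M.design t}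

/-- `n_t`, the number of runs at level `t`. -/
def n (t : Fin s) : ℕ := (M.design t).card

/-- Code outputs `y = (y_t)`, where `y_t` is the vector of output values over the design of
level `t`. -/
abbrev Output : Type := ∀ t, M.Run t → ℝ

/-- Indices of the location parameters of level `t`: those of `β_t`, and, if `t` is not the lowest
level, one more for the scale discrepancy between the level below and level `t`. -/
abbrev LocIdx (t : Fin s) : Type := Fin (M.p t) ⊕ {_u : Unit // 0 < t.val}

/-- Indices of the parameters `(σ²_t, φ_t)`. -/
abbrev ScaleIdx (d : ℕ) : Type := Unit ⊕ Fin d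

/-- Indices of all the parameters of level `t`. -/
abbrev ParamIdx (t : Fin s) : Type := M.LocIdx t ⊕ ScaleIdx d

/-- The parameter vectors `θ_t` of level `t`. -/
abbrev LevelParam (t : Fin s) : Type := M.ParamIdx t → ℝ

/-- The parameter vectors `θ = (θ_t)`. -/
abbrev Param : Type := ∀ t, M.LevelParam t

variable {M}

/-- The location parameters of level `t`. -/
def loc {t : Fin s} (ϑ : M.LevelParam t) : M.LocIdx t → ℝ := fun j => ϑ (Sum.inl j)

/-- The parameters `(σ²_t, φ_t)` of level `t`. -/
def scale {t : Fin s} (ϑ : M.LevelParam t) : ScaleIdx d → ℝ := fun j => ϑ (Sum.inr j)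

/-- The variance `σ²_t`. -/
def var {t : Fin s} (ϑ : M.LevelParam t) : ℝ := ϑ (Sum.inr (Sum.inl ()))

/-- The range parameters `φ_t`. -/
def range {t : Fin s} (ϑ : M.LevelParam t) : Fin d → ℝ := fun k => ϑ (Sum.inr (Sum.inr k))

/-- The values of `(σ²_t, φ_t)`: all coordinates are positive. -/
def scaleSpace (d : ℕ) : Set (ScaleIdx d → ℝ) := {ψ | ∀ j, 0 < ψ j}

variable (M)

/-- The parameter space of level `t`. -/
def levelSpace (t : Fin s) : Set (M.LevelParam t) := {ϑ | scale ϑ ∈ scaleSpace d}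

/-- The parameter space of the model. -/
def paramSpace : Set M.Param := {θ | ∀ t, θ t ∈ M.levelSpace t}

/-- `q_t`, the number of columns of `X_t`. -/
def q (t : Fin s) : ℕ := Fintype.card (M.LocIdx t)

/-- The correlation matrix `R_t(φ_t)`. -/
def R (t : Fin s) (φ : Fin d → ℝ) : Matrix (M.Run t) (M.Run t) ℝ :=
  Matrix.of fun x x' => M.r x x' φ

/-- The element-wise derivative of `R_t` with respect to the `k`-th range parameter. -/
def Rdot (t : Fin s) (k : Fin d) (φ : Fin d → ℝ) : Matrix (M.Run t) (M.Run t) ℝ :=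
  Matrix.of fun x x' => deriv (fun u => M.r x x' (Function.update φ k u)) (φ k)

/-- The matrix `X_t`: `X_t = H_t` at the lowest level, and `X_t = [H_t, W]` above it, where `W` is
the vector of the outputs of the code of the level below over the design of level `t`. -/
def X (y : M.Output) (t : Fin s) : Matrix (M.Run t) (M.LocIdx t) ℝ :=
  Matrix.of fun x j =>
    match j with
    | Sum.inl i => M.h t x i
    | Sum.inr _ =>
        let t' : Fin s := ⟨t.val - 1, lt_of_le_of_lt (Nat.sub_le _ _) t.isLt⟩
        y t' ⟨x.1, M.nested (show t' ≤ t from Nat.sub_le _ _) x.2⟩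

/-- The conditional density of `y_t` given the outputs of the level below (the density of `y_t` if
`t` is the lowest level), that is, the density of `𝒩(X_t b_t, σ²_t R_t)` at `y_t`. -/
def condDensity (t : Fin s) (ϑ : M.LevelParam t) (y : M.Output) : ℝ :=
  normalDensity ((M.X y t).mulVec (loc ϑ)) (var ϑ • M.R t (range ϑ)) (y t)

/-- The likelihood `L(y ∣ θ)`. -/
def likelihood (θ : M.Param) (y : M.Output) : ℝ :=
  ∏ t, M.condDensity t (θ t) y

/-- The log-likelihood as a function of the `i`-th parameter of level `t`, all other parameters
being fixed. -/
def logLikelihoodAlong (θ : M.Param) (t : Fin s) (i : M.ParamIdx t) (y : M.Output) (u : ℝ) : ℝ :=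
  Real.log (M.likelihood (Function.update θ t (Function.update (θ t) i u)) y)

/-- The partial derivative of the log-likelihood in the `i`-th parameter of level `t`. -/
def score (θ : M.Param) (t : Fin s) (i : M.ParamIdx t) (y : M.Output) : ℝ :=
  deriv (M.logLikelihoodAlong θ t i y) (θ t i)

/-- The integrand of the `(i, j)` entry of the Fisher information of level `t`, a function of the
value `z` of `y_t`. -/
def fisherIntegrand (y : M.Output) (θ : M.Param) (t : Fin s) (i j : M.ParamIdx t)
    (z : M.Run t → ℝ) : ℝ :=
  M.score θ t i (Function.update y t z) * M.score θ t j (Function.update y t z) *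
    M.condDensity t (θ t) (Function.update y t z)

/-- The Fisher information matrix of `θ_t`, the other parameters being fixed. The expectation is
taken under the conditional sampling distribution of `y_t` given the outputs of the lower levels,
so that `X_t` is a fixed design matrix. (The score does not depend on the outputs of the higher
levels.) -/
def fisher (y : M.Output) (θ : M.Param) (t : Fin s) : Matrix (M.ParamIdx t) (M.ParamIdx t) ℝ :=
  Matrix.of fun i j => ∫ z : M.Run t → ℝ, M.fisherIntegrand y θ t i j z

/-- The block of the Fisher information of level `t` that belongs to the location parameters. -/
def fisherLoc (y : M.Output) (θ : M.Param) (t : Fin s) : Matrix (M.LocIdx t) (M.LocIdx t) ℝ :=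
  (M.fisher y θ t).toBlocks₁₁

/-- The block of the Fisher information of level `t` that belongs to `(σ²_t, φ_t)`. -/
def fisherScale (y : M.Output) (θ : M.Param) (t : Fin s) : Matrix (ScaleIdx d) (ScaleIdx d) ℝ :=
  (M.fisher y θ t).toBlocks₂₂

/-- The Fisher information of all levels is well defined on the parameter space: the log-likelihood
has all partial derivatives, and the products of the scores are integrable. -/
def FisherWellDefined (y : M.Output) : Prop :=
  ∀ θ ∈ M.paramSpace, ∀ t,
    (∀ (i : M.ParamIdx t) (z : M.Run t → ℝ),
      DifferentiableAt ℝ (M.logLikelihoodAlong θ t i (Function.update y t z)) (θ t i)) ∧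
    ∀ i j : M.ParamIdx t, MeasureTheory.Integrable (M.fisherIntegrand y θ t i j)

/-- `π` is an independent Jeffreys prior of the first kind: the levels are a priori independent,
at each level the location parameters and `(σ²_t, φ_t)` are a priori independent, and each of
these two blocks has the Jeffreys-rule prior that belongs to it when all the other parameters are
fixed, whatever their values. -/
def IsIndepJeffreysOne (y : M.Output) (π : M.Param → ℝ) : Prop :=
  ∃ (f : ∀ t, (M.LocIdx t → ℝ) → ℝ) (g : Fin s → (ScaleIdx d → ℝ) → ℝ),
    (∀ t, ∀ θ ∈ M.paramSpace,
      ProportionalOn Set.univ (f t) (fun b =>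
        Real.sqrt (M.fisherLoc y (Function.update θ t (Sum.elim b (scale (θ t)))) t).det)) ∧
    (∀ t, ∀ θ ∈ M.paramSpace,
      ProportionalOn (scaleSpace d) (g t) (fun ψ =>
        Real.sqrt (M.fisherScale y (Function.update θ t (Sum.elim (loc (θ t)) ψ)) t).det)) ∧
    ProportionalOn M.paramSpace π (fun θ => ∏ t, f t (loc (θ t)) * g t (scale (θ t)))

/-- `π` is an independent Jeffreys prior of the second kind: the levels are a priori independent,
and each `θ_t` has the Jeffreys-rule prior that belongs to it when the parameters of all the other
levels are fixed, whatever their values. -/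
def IsIndepJeffreysTwo (y : M.Output) (π : M.Param → ℝ) : Prop :=
  ∃ f : ∀ t, M.LevelParam t → ℝ,
    (∀ t, ∀ θ ∈ M.paramSpace,
      ProportionalOn (M.levelSpace t) (f t) (fun ϑ =>
        Real.sqrt (M.fisher y (Function.update θ t ϑ) t).det)) ∧
    ProportionalOn M.paramSpace π (fun θ => ∏ t, f t (θ t))

/-- `π(β, γ, σ², φ) ∝ π₀(φ) / ∏ₜ (σ²_t)^{a_t}` on the parameter space. -/
def HasGeneralForm (π : M.Param → ℝ) (a : Fin s → ℝ) (π₀ : (Fin s → Fin d → ℝ) → ℝ) : Prop :=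
  ProportionalOn M.paramSpace π
    (fun θ => π₀ (fun t => range (θ t)) / ∏ t, var (θ t) ^ a t)

/-- `U_{t,k} = Ṙ_t^k R_t⁻¹`. -/
def U (t : Fin s) (k : Fin d) (φ : Fin d → ℝ) : Matrix (M.Run t) (M.Run t) ℝ :=
  M.Rdot t k φ * (M.R t φ)⁻¹

/-- The symmetric `(d + 1) × (d + 1)` matrix `I_t^J(φ_t)`. -/
def IJ (t : Fin s) (φ : Fin d → ℝ) : Matrix (Unit ⊕ Fin d) (Unit ⊕ Fin d) ℝ :=
  Matrix.fromBlocks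
    (Matrix.of fun _ _ => (M.n t : ℝ))
    (Matrix.of fun _ k => (M.U t k φ).trace)
    (Matrix.of fun k _ => (M.U t k φ).trace)
    (Matrix.of fun k l => (M.U t k φ * M.U t l φ).trace)

/-- `X_tᵀ R_t⁻¹ X_t`. -/
def XRX (y : M.Output) (t : Fin s) (φ : Fin d → ℝ) : Matrix (M.LocIdx t) (M.LocIdx t) ℝ :=
  (M.X y t).transpose * (M.R t φ)⁻¹ * M.X y t

end CokrigingModel

end

/-! The likelihood is a product over levels, and only the `t`-th factor involves `θ_t`. Given the
lower levels, `X_t` is fixed and `y_t` is normal with mean `m = X_t b_t` and covariance `C = σ²_t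
R_t`, so everything reduces to the Fisher information of a normal family.

Moving `(m, C)` in a direction `(a, A)` gives a score that is quadratic in the residual
(`hasDerivAt_log_normalDensity`, by Jacobi's formula and the derivative of the inverse). Writing `C
= L Lᵀ` and the residual as `L w` turns it into a polynomial in a standard normal `w`. Stein's
identity then evaluates the expected product of two scores as `aᵀ C⁻¹ b + ½ tr(C⁻¹ A C⁻¹ B)`
(`integral_normalScore_mul_normalScore`).

Location parameters move only the mean and `(σ²_t, φ_t)` only the covariance, so the information is
block diagonal (`fisher_eq_fromBlocks`), with blocks `σ_t⁻² X_tᵀ R_t⁻¹ X_t` and `½ D I_t^J D`, where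
`D = diag(σ_t⁻², 1, …, 1)`. The square roots of their determinants are `|X_tᵀ R_t⁻¹ X_t|^{1/2}
(σ²_t)^{-q_t/2}` and a constant times `|I_t^J|^{1/2} / σ²_t`. For the first kind the former is
constant in `b_t` and is absorbed into the proportionality; for the second kind both factors
survive. -/

noncomputable section

/-! ### Polynomial moments of the standard normal distribution -/

section GaussianMoments

open MeasureTheory ProbabilityTheory

/-- The density of the standard normal distribution on `ℝ^ι`. -/
def stdNormalDensity {ι : Type*} [Fintype ι] (w : ι → ℝ) : ℝ :=
  ∏ a, gaussianPDFReal 0 1 (w a)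

lemma hasDerivAt_gaussianPDFReal_zero_one (x : ℝ) :
    HasDerivAt (gaussianPDFReal 0 1) (-x * gaussianPDFReal 0 1 x) x := by
  have h : gaussianPDFReal 0 1 = fun x => (Real.sqrt (2 * Real.pi))⁻¹ * Real.exp (-x ^ 2 / 2) := by
    funext x
    simp [gaussianPDFReal]
  rw [h]
  have h1 : HasDerivAt (fun x : ℝ => -x ^ 2 / 2) (-x) x := by
    have := ((hasDerivAt_pow 2 x).neg).div_const 2
    convert! this using 1
    push_cast
    ring
  convert! (h1.exp).const_mul _ using 1
  ring

lemma integrable_pow_mul_gaussianPDFReal (m : ℕ) :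
    Integrable (fun x : ℝ => x ^ m * gaussianPDFReal 0 1 x) := by
  have h := integrable_rpow_mul_exp_neg_mul_sq (b := 1 / 2) (by norm_num) (s := m)
    (by have : (0 : ℝ) ≤ m := Nat.cast_nonneg m
        linarith)
  refine (h.const_mul (Real.sqrt (2 * Real.pi))⁻¹).congr (Filter.Eventually.of_forall fun x => ?_)
  have e : -x ^ 2 / 2 = -(1 / 2) * x ^ 2 := by ring
  simp only [gaussianPDFReal, NNReal.coe_one, mul_one, sub_zero, Real.rpow_natCast, e]
  ring

/-- Integration by parts: the derivative of `x ^ m` times the density integrates to zero. For `m =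
0` the truncated exponent `m - 1` is harmless, since its factor `m` vanishes. -/
lemma integral_pow_succ_mul_gaussianPDFReal (m : ℕ) :
    ∫ x : ℝ, x ^ (m + 1) * gaussianPDFReal 0 1 x =
      m * ∫ x : ℝ, x ^ (m - 1) * gaussianPDFReal 0 1 x := by
  have h1 := integrable_pow_mul_gaussianPDFReal (m + 1)
  have h2 := (integrable_pow_mul_gaussianPDFReal (m - 1)).const_mul (m : ℝ)
  have h := integral_eq_zero_of_hasDerivAt_of_integrable
    (f := fun x : ℝ => x ^ m * gaussianPDFReal 0 1 x)
    (f' := fun x : ℝ => m * (x ^ (m - 1) * gaussianPDFReal 0 1 x)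
      - x ^ (m + 1) * gaussianPDFReal 0 1 x)
    (fun x => by
      convert! (hasDerivAt_pow m x).mul (hasDerivAt_gaussianPDFReal_zero_one x) using 1
      ring)
    (h2.sub h1) (integrable_pow_mul_gaussianPDFReal m)
  rw [integral_sub h2 h1, integral_const_mul] at h
  linarith

variable {ι : Type*} [Fintype ι]

lemma eval_monomial_mul_stdNormalDensity (m : ι →₀ ℕ) (c : ℝ) (w : ι → ℝ) :
    MvPolynomial.eval w (MvPolynomial.monomial m c) * stdNormalDensity w =
      c * ∏ a, (w a ^ m a * gaussianPDFReal 0 1 (w a)) := by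
  rw [MvPolynomial.eval_monomial, Finsupp.prod_fintype _ _ (by simp), stdNormalDensity,
    Finset.prod_mul_distrib]
  ring

lemma integrable_eval_mul_stdNormalDensity (p : MvPolynomial ι ℝ) :
    Integrable (fun w : ι → ℝ => MvPolynomial.eval w p * stdNormalDensity w) := by
  induction p using MvPolynomial.induction_on' with
  | monomial m c =>
    simp only [eval_monomial_mul_stdNormalDensity]
    exact (Integrable.fintype_prod (fun a => integrable_pow_mul_gaussianPDFReal (m a))).const_mul c
  | add p q hp hq =>
    simp only [map_add, add_mul]
    exact hp.add hq

/-- The expectation of a polynomial under the standard normal distribution on `ℝ^ι`. -/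
def normalExpectation : MvPolynomial ι ℝ →ₗ[ℝ] ℝ where
  toFun p := ∫ w : ι → ℝ, MvPolynomial.eval w p * stdNormalDensity w
  map_add' p q := by
    simp only [map_add, add_mul]
    exact integral_add (integrable_eval_mul_stdNormalDensity p)
      (integrable_eval_mul_stdNormalDensity q)
  map_smul' c p := by
    simp only [MvPolynomial.smul_eval, mul_assoc, integral_const_mul, RingHom.id_apply,
      smul_eq_mul]

lemma normalExpectation_apply (p : MvPolynomial ι ℝ) :
    normalExpectation p = ∫ w : ι → ℝ, MvPolynomial.eval w p * stdNormalDensity w := rfl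

lemma normalExpectation_monomial (m : ι →₀ ℕ) (c : ℝ) :
    normalExpectation (MvPolynomial.monomial m c) =
      c * ∏ a, ∫ x : ℝ, x ^ m a * gaussianPDFReal 0 1 x := by
  simp only [normalExpectation_apply, eval_monomial_mul_stdNormalDensity, integral_const_mul]
  rw [← integral_fintype_prod_volume_eq_prod (fun a (x : ℝ) => x ^ m a * gaussianPDFReal 0 1 x)]

/-- Stein's identity for polynomials. -/
lemma normalExpectation_X_mul [DecidableEq ι] (i : ι) (p : MvPolynomial ι ℝ) :
    normalExpectation (MvPolynomial.X i * p) = normalExpectation (MvPolynomial.pderiv i p) := by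
  induction p using MvPolynomial.induction_on' with
  | monomial m c =>
    rw [mul_comm, MvPolynomial.X, MvPolynomial.monomial_mul, MvPolynomial.pderiv_monomial,
      normalExpectation_monomial, normalExpectation_monomial,
      ← Finset.mul_prod_erase _ _ (Finset.mem_univ i),
      ← Finset.mul_prod_erase _ (fun a => ∫ x : ℝ, x ^ ((m - Finsupp.single i 1 : ι →₀ ℕ) a) *
        gaussianPDFReal 0 1 x) (Finset.mem_univ i)]
    -- Both exponents equal `m a` away from `i`, so only the factor at `i` needs the one-dimensional
    -- recursion.
    have h : ∀ a ∈ Finset.univ.erase i, (m + Finsupp.single i 1 : ι →₀ ℕ) a =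
        (m - Finsupp.single i 1 : ι →₀ ℕ) a := by
      intro a ha
      simp [(Finset.ne_of_mem_erase ha).symm]
    rw [Finset.prod_congr rfl fun a ha => by rw [h a ha]]
    simp only [Finsupp.add_apply, Finsupp.single_eq_same, Finsupp.tsub_apply,
      integral_pow_succ_mul_gaussianPDFReal]
    ring
  | add p q hp hq => simp only [mul_add, map_add, hp, hq]

lemma normalExpectation_one : normalExpectation (1 : MvPolynomial ι ℝ) = 1 := by
  have := normalExpectation_monomial (0 : ι →₀ ℕ) 1
  simpa [integral_gaussianPDFReal_eq_one 0 one_ne_zero] using this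

lemma normalExpectation_C (c : ℝ) : normalExpectation (MvPolynomial.C c : MvPolynomial ι ℝ) = c := by
  rw [← mul_one (MvPolynomial.C c), MvPolynomial.C_mul', map_smul, normalExpectation_one]
  simp

/-- The polynomial `∑ vᵢ Xᵢ + ½ (∑ Aᵢⱼ Xᵢ Xⱼ - tr A)`. -/
def scorePolynomial (v : ι → ℝ) (A : Matrix ι ι ℝ) : MvPolynomial ι ℝ :=
  ∑ i, v i • MvPolynomial.X i +
    (1 / 2 : ℝ) • (∑ i, ∑ j, A i j • (MvPolynomial.X i * MvPolynomial.X j) -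
      MvPolynomial.C A.trace)

/-- Stein's identity removes one variable from the linear part and two from the quadratic part. The
second removal also differentiates `X j`, which yields `tr A` times the expectation of `Q`; the
constant `-tr A` in the score cancels it. -/
lemma normalExpectation_scorePolynomial_mul [DecidableEq ι] (v : ι → ℝ) (A : Matrix ι ι ℝ)
    (Q : MvPolynomial ι ℝ) :
    normalExpectation (scorePolynomial v A * Q) =
      ∑ i, v i * normalExpectation (MvPolynomial.pderiv i Q) +
        1 / 2 * ∑ i, ∑ j, A i j *
          normalExpectation (MvPolynomial.pderiv j (MvPolynomial.pderiv i Q)) := by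
  have hXX : ∀ i j, normalExpectation (MvPolynomial.X i * MvPolynomial.X j * Q) =
      (if i = j then normalExpectation Q else 0) +
        normalExpectation (MvPolynomial.pderiv j (MvPolynomial.pderiv i Q)) := by
    intro i j
    rw [mul_assoc, normalExpectation_X_mul, Derivation.leibniz, MvPolynomial.pderiv_X, map_add,
      smul_eq_mul, smul_eq_mul, normalExpectation_X_mul, add_comm, Pi.single_apply]
    by_cases h : i = j
    · simp [h]
    · simp [h, Ne.symm h]
  simp only [scorePolynomial, add_mul, sub_mul, smul_mul_assoc, Finset.sum_mul, map_add, map_sub,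
    map_smul, map_sum, smul_eq_mul, hXX, normalExpectation_X_mul, mul_add, mul_ite, mul_zero,
    Finset.sum_add_distrib, Finset.sum_ite_eq, Finset.mem_univ, if_true, MvPolynomial.C_mul',
    Matrix.trace, Matrix.diag_apply]
  rw [← Finset.sum_mul]
  ring

lemma pderiv_scorePolynomial [DecidableEq ι] (v : ι → ℝ) {A : Matrix ι ι ℝ} (hA : A.IsSymm)
    (i : ι) :
    MvPolynomial.pderiv i (scorePolynomial v A) =
      MvPolynomial.C (v i) + ∑ k, A i k • MvPolynomial.X k := by
  have h : ∀ a b, A a b = A b a := fun a b => hA.apply b a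
  have hs : MvPolynomial.pderiv i (∑ a, ∑ b, A a b • (MvPolynomial.X a * MvPolynomial.X b)) =
      (2 : ℝ) • ∑ k, A i k • (MvPolynomial.X k : MvPolynomial ι ℝ) := by
    simp only [map_sum, Derivation.map_smul, Derivation.leibniz, MvPolynomial.pderiv_X, smul_add,
      Finset.sum_add_distrib, smul_eq_mul, Pi.single_apply, mul_ite, mul_one, mul_zero, smul_ite,
      smul_zero, two_smul]
    rw [Finset.sum_comm (f := fun a b => if a = i then A a b • (MvPolynomial.X b : MvPolynomial ι ℝ) else 0)]
    simp [h _ i]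
  simp only [scorePolynomial, map_add, map_sub, Derivation.map_smul, hs, MvPolynomial.pderiv_C,
    sub_zero, smul_smul, map_sum, MvPolynomial.pderiv_X]
  norm_num
  simp [Pi.single_apply, MvPolynomial.smul_eq_C_mul]

/-- The first derivatives of the second factor are affine with mean `u i`, and its second
derivatives are the constants `B i j`, so the preceding formula terminates. -/
lemma normalExpectation_scorePolynomial_mul_scorePolynomial (v u : ι → ℝ) (A : Matrix ι ι ℝ)
    {B : Matrix ι ι ℝ} (hB : B.IsSymm) :
    normalExpectation (scorePolynomial v A * scorePolynomial u B) =
      v ⬝ᵥ u + 1 / 2 * (A * B).trace := by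
  classical
  have hX : ∀ k : ι, normalExpectation (MvPolynomial.X k : MvPolynomial ι ℝ) = 0 := fun k => by
    rw [← mul_one (MvPolynomial.X k), normalExpectation_X_mul]
    simp
  have h2 : ∀ i j, MvPolynomial.pderiv j (∑ k, B i k • (MvPolynomial.X k : MvPolynomial ι ℝ)) =
      MvPolynomial.C (B i j) := fun i j => by
    simp [MvPolynomial.pderiv_X, Pi.single_apply, MvPolynomial.smul_eq_C_mul]
  rw [normalExpectation_scorePolynomial_mul]
  simp only [pderiv_scorePolynomial u hB, map_add, map_sum, map_smul, hX, normalExpectation_C,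
    smul_zero, Finset.sum_const_zero, add_zero, MvPolynomial.pderiv_C, zero_add]
  simp only [← map_sum, h2, normalExpectation_C]
  simp [dotProduct, Matrix.trace, Matrix.mul_apply, hB.apply]

lemma eval_scorePolynomial (v : ι → ℝ) (A : Matrix ι ι ℝ) (w : ι → ℝ) :
    MvPolynomial.eval w (scorePolynomial v A) =
      v ⬝ᵥ w + 1 / 2 * (w ⬝ᵥ A.mulVec w - A.trace) := by
  simp only [scorePolynomial, map_add, map_sum, MvPolynomial.smul_eval, MvPolynomial.eval_X,
    map_sub, map_mul, MvPolynomial.eval_C, dotProduct, Matrix.mulVec, Finset.mul_sum]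
  congr 3
  exact Finset.sum_congr rfl fun i _ => Finset.sum_congr rfl fun j _ => by ring

end GaussianMoments

/-! ### Whitening a normal density, and its Fisher information -/

section NormalDensity

open MeasureTheory ProbabilityTheory Matrix

variable {ι : Type*} [Fintype ι] [DecidableEq ι]

open scoped MatrixOrder Matrix.Norms.L2Operator in
lemma Matrix.PosDef.exists_eq_mul_transpose {C : Matrix ι ι ℝ} (hC : C.PosDef) :
    ∃ L : Matrix ι ι ℝ, C = L * Lᵀ := by
  obtain ⟨B, hB⟩ := CStarAlgebra.nonneg_iff_eq_star_mul_self.mp hC.posSemidef.nonneg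
  refine ⟨Bᵀ, ?_⟩
  rw [hB, transpose_transpose, star_eq_conjTranspose, conjTranspose_eq_transpose_of_trivial]

omit [DecidableEq ι] in
lemma stdNormalDensity_eq (w : ι → ℝ) :
    stdNormalDensity w =
      (Real.sqrt ((2 * Real.pi) ^ Fintype.card ι))⁻¹ * Real.exp (-(w ⬝ᵥ w) / 2) := by
  simp only [stdNormalDensity, gaussianPDFReal, Finset.prod_mul_distrib, ← Real.exp_sum,
    NNReal.coe_one, mul_one, sub_zero, Finset.prod_const, Finset.card_univ]
  have h : Real.sqrt ((2 * Real.pi) ^ Fintype.card ι) = Real.sqrt (2 * Real.pi) ^ Fintype.card ι := by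
    rw [Real.sqrt_eq_iff_mul_self_eq (by positivity) (by positivity), ← mul_pow,
      Real.mul_self_sqrt (by positivity)]
  rw [inv_pow, h]
  congr 2
  simp [dotProduct, ← Finset.sum_div, pow_two]

/-- The quadratic form collapses because `Lᵀ (L Lᵀ)⁻¹ L = 1`, and the Jacobian `|det L|` cancels the
root of `det (L Lᵀ)`. -/
lemma normalDensity_affine (m w : ι → ℝ) {L : Matrix ι ι ℝ} (hL : L.det ≠ 0) :
    |L.det| * normalDensity m (L * Lᵀ) (m + L *ᵥ w) = stdNormalDensity w := by
  have hu : IsUnit L.det := isUnit_iff_ne_zero.mpr hL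
  have hq : (L *ᵥ w) ⬝ᵥ ((L * Lᵀ)⁻¹ *ᵥ (L *ᵥ w)) = w ⬝ᵥ w := by
    rw [Matrix.mul_inv_rev, mulVec_mulVec, Matrix.mul_assoc, nonsing_inv_mul L hu, Matrix.mul_one,
      ← transpose_nonsing_inv, mulVec_transpose, dotProduct_comm, ← dotProduct_mulVec,
      mulVec_mulVec, nonsing_inv_mul L hu, one_mulVec]
  rw [normalDensity, add_sub_cancel_left, hq, stdNormalDensity_eq, det_mul, det_transpose,
    Real.sqrt_mul (by positivity), Real.sqrt_mul_self_eq_abs]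
  have : |L.det| ≠ 0 := abs_ne_zero.mpr hL
  field_simp

lemma map_affine_volume (m : ι → ℝ) {L : Matrix ι ι ℝ} (hL : L.det ≠ 0) :
    Measure.map (fun w => m + L *ᵥ w) volume = ENNReal.ofReal |L.det⁻¹| • volume := by
  have h : (fun w => m + L *ᵥ w) = (fun z => m + z) ∘ toLin' L := by
    funext w
    simp
  rw [h, ← Measure.map_map (measurable_const_add m)
    (LinearMap.continuous_on_pi (toLin' L)).measurable,
    Real.map_matrix_volume_pi_eq_smul_volume_pi hL, Measure.map_smul, map_add_left_eq_self]

/-- Change of variables along a measurable embedding asks nothing of the integrand, so `g` can be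
arbitrary in the two lemmas that follow. -/
lemma measurableEmbedding_affine (m : ι → ℝ) {L : Matrix ι ι ℝ} (hL : L.det ≠ 0) :
    MeasurableEmbedding (fun w => m + L *ᵥ w) := by
  refine Continuous.measurableEmbedding (by fun_prop) ?_
  exact (add_right_injective m).comp
    (mulVec_injective_iff_isUnit.mpr ((isUnit_iff_isUnit_det L).mpr (isUnit_iff_ne_zero.mpr hL)))

lemma integrable_mul_normalDensity_iff (m : ι → ℝ) {L : Matrix ι ι ℝ} (hL : L.det ≠ 0)
    (g : (ι → ℝ) → ℝ) :
    Integrable (fun z => g z * normalDensity m (L * Lᵀ) z) ↔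
      Integrable (fun w => g (m + L *ᵥ w) * stdNormalDensity w) := by
  have hd : |L.det| ≠ 0 := abs_ne_zero.mpr hL
  have h := (measurableEmbedding_affine m hL).integrable_map_iff (μ := volume)
    (g := fun z => g z * normalDensity m (L * Lᵀ) z)
  rw [map_affine_volume m hL, integrable_smul_measure (by simpa using hL) (by simp)] at h
  rw [h, ← integrable_const_mul_iff (isUnit_iff_ne_zero.mpr hd)]
  refine integrable_congr (Filter.Eventually.of_forall fun w => ?_)
  simp only [Function.comp_apply, ← normalDensity_affine m w hL]
  ring

lemma integral_mul_normalDensity (m : ι → ℝ) {L : Matrix ι ι ℝ} (hL : L.det ≠ 0)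
    (g : (ι → ℝ) → ℝ) :
    ∫ z, g z * normalDensity m (L * Lᵀ) z = ∫ w, g (m + L *ᵥ w) * stdNormalDensity w := by
  have hd : |L.det| ≠ 0 := abs_ne_zero.mpr hL
  have h := (measurableEmbedding_affine m hL).integral_map (μ := volume)
    (g := fun z => g z * normalDensity m (L * Lᵀ) z)
  rw [map_affine_volume m hL, integral_smul_measure, ENNReal.toReal_ofReal (abs_nonneg _), abs_inv,
    smul_eq_mul, inv_mul_eq_iff_eq_mul₀ hd, ← integral_const_mul] at h
  rw [h]
  refine integral_congr_ae (Filter.Eventually.of_forall fun w => ?_)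
  simp only [← normalDensity_affine m w hL]
  ring

/-- The derivative of the log-density of `𝒩(m, C)` in a direction `(a, A)` of the parameters
`(m, C)`, as a function of the deviation `e` from the mean. -/
def normalScore (C : Matrix ι ι ℝ) (a : ι → ℝ) (A : Matrix ι ι ℝ) (e : ι → ℝ) : ℝ :=
  a ⬝ᵥ (C⁻¹ *ᵥ e) + 1 / 2 * ((C⁻¹ *ᵥ e) ⬝ᵥ (A *ᵥ (C⁻¹ *ᵥ e)) - (C⁻¹ * A).trace)

lemma normalScore_mulVec {L : Matrix ι ι ℝ} (hL : L.det ≠ 0) (a : ι → ℝ) (A : Matrix ι ι ℝ)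
    (w : ι → ℝ) :
    normalScore (L * Lᵀ) a A (L *ᵥ w) =
      MvPolynomial.eval w (scorePolynomial (L⁻¹ *ᵥ a) (L⁻¹ * A * L⁻¹ᵀ)) := by
  have hu : IsUnit L.det := isUnit_iff_ne_zero.mpr hL
  have h1 : (L * Lᵀ)⁻¹ = L⁻¹ᵀ * L⁻¹ := by rw [Matrix.mul_inv_rev, transpose_nonsing_inv]
  have h2 : (L * Lᵀ)⁻¹ *ᵥ (L *ᵥ w) = L⁻¹ᵀ *ᵥ w := by
    rw [h1, mulVec_mulVec, Matrix.mul_assoc, nonsing_inv_mul L hu, Matrix.mul_one]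
  have h3 : ∀ u v, u ⬝ᵥ (L⁻¹ᵀ *ᵥ v) = (L⁻¹ *ᵥ u) ⬝ᵥ v := fun u v => by
    rw [dotProduct_mulVec, vecMul_transpose]
  rw [normalScore, eval_scorePolynomial, h2, h1, h3, Matrix.mul_assoc, Matrix.trace_mul_comm,
    dotProduct_comm (L⁻¹ᵀ *ᵥ w), h3, mulVec_mulVec, mulVec_mulVec, Matrix.mul_assoc,
    dotProduct_comm w]

/-- The Fisher information of the family of normal distributions. -/
lemma integral_normalScore_mul_normalScore (m : ι → ℝ) {C : Matrix ι ι ℝ} (hC : C.PosDef)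
    (a b : ι → ℝ) (A : Matrix ι ι ℝ) {B : Matrix ι ι ℝ} (hB : B.IsSymm) :
    Integrable (fun z => normalScore C a A (z - m) * normalScore C b B (z - m) *
      normalDensity m C z) ∧
    ∫ z, normalScore C a A (z - m) * normalScore C b B (z - m) * normalDensity m C z =
      a ⬝ᵥ (C⁻¹ *ᵥ b) + 1 / 2 * (C⁻¹ * A * (C⁻¹ * B)).trace := by
  obtain ⟨L, rfl⟩ := hC.exists_eq_mul_transpose
  have hL : L.det ≠ 0 := fun h => hC.det_pos.ne' (by rw [det_mul, h, zero_mul])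
  have h1 : (L * Lᵀ)⁻¹ = L⁻¹ᵀ * L⁻¹ := by rw [Matrix.mul_inv_rev, transpose_nonsing_inv]
  rw [integrable_mul_normalDensity_iff m hL, integral_mul_normalDensity m hL]
  simp only [add_sub_cancel_left, normalScore_mulVec hL, ← map_mul]
  refine ⟨integrable_eval_mul_stdNormalDensity _, ?_⟩
  rw [← normalExpectation_apply, normalExpectation_scorePolynomial_mul_scorePolynomial]
  · rw [h1, ← mulVec_mulVec, dotProduct_mulVec a, vecMul_transpose]
    congr 2
    rw [← Matrix.mul_assoc _ _ L⁻¹ᵀ, Matrix.trace_mul_comm]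
    simp only [Matrix.mul_assoc]
  · rw [IsSymm, transpose_mul, transpose_mul, transpose_transpose, hB.eq, Matrix.mul_assoc]

end NormalDensity

/-! ### Differentiating the log-density along a curve of parameters -/

section NormalDensityDeriv

open Matrix

variable {ι : Type*} [Fintype ι] [DecidableEq ι]

/-- Jacobi's formula. Differentiating the Leibniz expansion gives a sum over columns; by Cramer's
rule, the `i`-th diagonal entry of `adj(C) C'` is the determinant of `C` with column `i` replaced by
that of `C'`. -/
lemma HasDerivAt.matrix_det {C : ℝ → Matrix ι ι ℝ} {C' : Matrix ι ι ℝ} {u₀ : ℝ}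
    (h : ∀ i j, HasDerivAt (fun u => C u i j) (C' i j) u₀) :
    HasDerivAt (fun u => (C u).det) ((C u₀).adjugate * C').trace u₀ := by
  have hp : ∀ σ : Equiv.Perm ι, HasDerivAt (fun u => ∏ i, C u (σ i) i)
      (∑ i, (∏ j ∈ Finset.univ.erase i, C u₀ (σ j) j) • C' (σ i) i) u₀ := fun σ =>
    HasDerivAt.fun_finsetProd fun i _ => h (σ i) i
  have hs : HasDerivAt (fun u => (C u).det) (∑ σ : Equiv.Perm ι, ((Equiv.Perm.sign σ : ℤ) : ℝ) *
      ∑ i, (∏ j ∈ Finset.univ.erase i, C u₀ (σ j) j) • C' (σ i) i) u₀ := by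
    simp only [det_apply']
    exact HasDerivAt.fun_sum fun σ _ => (hp σ).const_mul _
  convert! hs using 1
  have hc : ∀ i, ((C u₀).adjugate * C') i i = ((C u₀).updateCol i fun k => C' k i).det := fun i => by
    rw [← cramer_apply, cramer_eq_adjugate_mulVec]
    rfl
  simp only [Matrix.trace, diag_apply, hc, det_apply', Finset.mul_sum]
  rw [Finset.sum_comm]
  refine Finset.sum_congr rfl fun σ _ => Finset.sum_congr rfl fun i _ => ?_
  rw [← Finset.mul_prod_erase _ _ (Finset.mem_univ i), updateCol_self,
    Finset.prod_congr rfl fun j hj => updateCol_ne (Finset.ne_of_mem_erase hj), smul_eq_mul]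
  ring

lemma differentiableAt_matrix_inv {C : ℝ → Matrix ι ι ℝ} {C' : Matrix ι ι ℝ} {u₀ : ℝ}
    (h : ∀ i j, HasDerivAt (fun u => C u i j) (C' i j) u₀) (hC : (C u₀).det ≠ 0) (i j : ι) :
    DifferentiableAt ℝ (fun u => (C u)⁻¹ i j) u₀ := by
  have hadj : DifferentiableAt ℝ (fun u => (C u).adjugate i j) u₀ := by
    simp only [adjugate_apply]
    -- The adjugate entry is the determinant of `C` with row `j` replaced by a constant vector,
    -- hence the zero row in the derivative.
    refine (HasDerivAt.matrix_det (C' := C'.updateRow j 0) fun a b => ?_).differentiableAt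
    by_cases ha : a = j
    · subst ha
      simpa using hasDerivAt_const u₀ _
    · simpa [updateRow_ne ha] using h a b
  simp only [inv_def, Matrix.smul_apply, Ring.inverse_eq_inv', smul_eq_mul]
  exact ((HasDerivAt.matrix_det h).differentiableAt.inv hC).mul hadj

lemma HasDerivAt.matrix_inv {C : ℝ → Matrix ι ι ℝ} {C' : Matrix ι ι ℝ} {u₀ : ℝ}
    (h : ∀ i j, HasDerivAt (fun u => C u i j) (C' i j) u₀) (hC : (C u₀).det ≠ 0) (i j : ι) :
    HasDerivAt (fun u => (C u)⁻¹ i j) ((-((C u₀)⁻¹ * C' * (C u₀)⁻¹)) i j) u₀ := by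
  set D : Matrix ι ι ℝ := of fun i j => _root_.deriv (fun u => (C u)⁻¹ i j) u₀ with hD
  have hd : ∀ i j, HasDerivAt (fun u => (C u)⁻¹ i j) (D i j) u₀ := fun i j =>
    (differentiableAt_matrix_inv h hC i j).hasDerivAt
  have hu : IsUnit (C u₀).det := isUnit_iff_ne_zero.mpr hC
  -- Differentiate `C⁻¹ C = 1`, which holds near `u₀` because the determinant stays nonzero there.
  have hz : D * C u₀ + (C u₀)⁻¹ * C' = 0 := by
    ext a b
    have h1 : HasDerivAt (fun u => ((C u)⁻¹ * C u) a b) ((D * C u₀ + (C u₀)⁻¹ * C') a b) u₀ := by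
      simp only [mul_apply, Matrix.add_apply, ← Finset.sum_add_distrib]
      exact HasDerivAt.fun_sum fun k _ => (hd a k).fun_mul (h k b)
    have h2 : HasDerivAt (fun u => ((C u)⁻¹ * C u) a b) 0 u₀ := by
      refine (hasDerivAt_const u₀ ((1 : Matrix ι ι ℝ) a b)).congr_of_eventuallyEq ?_
      filter_upwards [(HasDerivAt.matrix_det h).continuousAt.eventually_ne hC] with u hu'
      rw [nonsing_inv_mul _ (isUnit_iff_ne_zero.mpr hu')]
    exact h1.unique h2
  have hD' : D = -((C u₀)⁻¹ * C' * (C u₀)⁻¹) := by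
    have := congrArg (· * (C u₀)⁻¹) (eq_neg_of_add_eq_zero_left hz)
    simpa [Matrix.mul_assoc, mul_nonsing_inv _ hu] using this
  rw [← hD']
  exact hd i j

lemma normalDensity_pos {m : ι → ℝ} {C : Matrix ι ι ℝ} (hC : 0 < C.det) (z : ι → ℝ) :
    0 < normalDensity m C z := by
  unfold normalDensity
  positivity

lemma hasDerivAt_log_normalDensity {m : ℝ → ι → ℝ} {m' : ι → ℝ} {C : ℝ → Matrix ι ι ℝ}
    {C' : Matrix ι ι ℝ} {u₀ : ℝ} (hm : ∀ i, HasDerivAt (fun u => m u i) (m' i) u₀)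
    (h : ∀ i j, HasDerivAt (fun u => C u i j) (C' i j) u₀) (hC : (C u₀).PosDef) (z : ι → ℝ) :
    HasDerivAt (fun u => Real.log (normalDensity (m u) (C u) z))
      (normalScore (C u₀) m' C' (z - m u₀)) u₀ := by
  have hpos := hC.det_pos
  have hdet := HasDerivAt.matrix_det h
  have hsymm : ((C u₀)⁻¹)ᵀ = (C u₀)⁻¹ := by
    rw [transpose_nonsing_inv, ← conjTranspose_eq_transpose_of_trivial, hC.isHermitian.eq]
  have hlog : (fun u => Real.log (normalDensity (m u) (C u) z)) =ᶠ[nhds u₀] fun u =>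
      -(1 / 2) * (Real.log ((2 * Real.pi) ^ Fintype.card ι) + Real.log (C u).det) -
        1 / 2 * ∑ i, (z i - m u i) * ∑ j, (C u)⁻¹ i j * (z j - m u j) := by
    filter_upwards [hdet.continuousAt.eventually (lt_mem_nhds hpos)] with u hu
    rw [normalDensity, Real.log_mul (by positivity) (Real.exp_ne_zero _), Real.log_exp,
      Real.log_inv, Real.log_sqrt (by positivity), Real.log_mul (by positivity) hu.ne']
    simp only [dotProduct, mulVec, Pi.sub_apply]
    ring
  refine HasDerivAt.congr_of_eventuallyEq ?_ hlog
  have hi := HasDerivAt.matrix_inv h hpos.ne'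
  have he : ∀ i, HasDerivAt (fun u => z i - m u i) (-m' i) u₀ := fun i => (hm i).const_sub (z i)
  have hquad : HasDerivAt (fun u => ∑ i, (z i - m u i) * ∑ j, (C u)⁻¹ i j * (z j - m u j))
      (∑ i, (-m' i * (∑ j, (C u₀)⁻¹ i j * (z j - m u₀ j)) + (z i - m u₀ i) *
        ∑ j, ((-((C u₀)⁻¹ * C' * (C u₀)⁻¹)) i j * (z j - m u₀ j) + (C u₀)⁻¹ i j * -m' j))) u₀ :=
    HasDerivAt.fun_sum fun i _ => (he i).mul
      (HasDerivAt.fun_sum fun j _ => (hi i j).mul (he j))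
  have hl : HasDerivAt (fun u => Real.log (C u).det) ((C u₀)⁻¹ * C').trace u₀ := by
    convert! hdet.log hpos.ne' using 1
    rw [inv_def, Ring.inverse_eq_inv', Matrix.smul_mul, trace_smul, smul_eq_mul]
    field_simp
  convert! ((hl.const_add _).const_mul (-(1 / 2))).sub (hquad.const_mul (1 / 2)) using 1
  have e1 : ∑ i, (-m' i * (∑ j, (C u₀)⁻¹ i j * (z j - m u₀ j)) + (z i - m u₀ i) *
        ∑ j, ((-((C u₀)⁻¹ * C' * (C u₀)⁻¹)) i j * (z j - m u₀ j) + (C u₀)⁻¹ i j * -m' j)) =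
      (-m') ⬝ᵥ ((C u₀)⁻¹ *ᵥ (z - m u₀)) + (z - m u₀) ⬝ᵥ
        ((-((C u₀)⁻¹ * C' * (C u₀)⁻¹)) *ᵥ (z - m u₀) + (C u₀)⁻¹ *ᵥ (-m')) := by
    simp [dotProduct, mulVec, Finset.sum_add_distrib]
  -- Symmetry of the inverse makes the two terms in `m'` equal, which cancels the factor `1 / 2` on
  -- the mean part.
  have hs : ∀ v w, v ⬝ᵥ ((C u₀)⁻¹ *ᵥ w) = ((C u₀)⁻¹ *ᵥ v) ⬝ᵥ w := fun v w => by
    rw [dotProduct_mulVec, ← mulVec_transpose, hsymm]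
  rw [e1, normalScore, dotProduct_add, neg_mulVec, mulVec_neg, dotProduct_neg, dotProduct_neg,
    neg_dotProduct, ← mulVec_mulVec, ← mulVec_mulVec, hs (z - m u₀), hs (z - m u₀),
    dotProduct_comm _ m']
  ring

end NormalDensityDeriv

/-! ### Calculus of proportionality -/

section Proportional

variable {α : Type*} {S : Set α} {f g h : α → ℝ}

lemma ProportionalOn.refl (S : Set α) (f : α → ℝ) : ProportionalOn S f f :=
  ⟨1, one_pos, fun _ _ => (one_mul _).symm⟩

lemma ProportionalOn.symm (hfg : ProportionalOn S f g) : ProportionalOn S g f := by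
  obtain ⟨c, hc, H⟩ := hfg
  exact ⟨c⁻¹, inv_pos.mpr hc, fun x hx => by rw [H x hx, inv_mul_cancel_left₀ hc.ne']⟩

lemma ProportionalOn.trans (hfg : ProportionalOn S f g) (hgh : ProportionalOn S g h) :
    ProportionalOn S f h := by
  obtain ⟨c, hc, H⟩ := hfg
  obtain ⟨c', hc', H'⟩ := hgh
  exact ⟨c * c', mul_pos hc hc', fun x hx => by rw [H x hx, H' x hx, mul_assoc]⟩

lemma ProportionalOn.comp {β : Type*} {T : Set β} (hfg : ProportionalOn S f g) {e : β → α}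
    (he : ∀ x ∈ T, e x ∈ S) : ProportionalOn T (fun x => f (e x)) (fun x => g (e x)) := by
  obtain ⟨c, hc, H⟩ := hfg
  exact ⟨c, hc, fun x hx => H _ (he x hx)⟩

lemma ProportionalOn.mul {f' g' : α → ℝ} (hfg : ProportionalOn S f g)
    (hfg' : ProportionalOn S f' g') :
    ProportionalOn S (fun x => f x * f' x) (fun x => g x * g' x) := by
  obtain ⟨c, hc, H⟩ := hfg
  obtain ⟨c', hc', H'⟩ := hfg'
  exact ⟨c * c', mul_pos hc hc', fun x hx => by simp only [H x hx, H' x hx]; ring⟩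

lemma ProportionalOn.prod {κ : Type*} [Fintype κ] {f g : κ → α → ℝ}
    (hfg : ∀ k, ProportionalOn S (f k) (g k)) :
    ProportionalOn S (fun x => ∏ k, f k x) (fun x => ∏ k, g k x) := by
  choose c hc H using hfg
  refine ⟨∏ k, c k, Finset.prod_pos fun k _ => hc k, fun x hx => ?_⟩
  rw [← Finset.prod_mul_distrib]
  exact Finset.prod_congr rfl fun k _ => H k x hx

end Proportional

/-! ### The scores of the cokriging model -/

namespace CokrigingModel

open Matrix MeasureTheory

variable {d s : ℕ} (M : CokrigingModel d s)

/-- `X_t` uses only outputs of level `t - 1`. The truncated `t - 1` equals `t` only at the lowest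
level, where the extra column is absent. -/
lemma X_update_self (y : M.Output) (t : Fin s) (z : M.Run t → ℝ) :
    M.X (Function.update y t z) t = M.X y t := by
  ext x j
  rcases j with j | ⟨_, hj⟩
  · rfl
  · simp only [X, of_apply]
    rw [Function.update_of_ne]
    intro h
    have := congrArg Fin.val h
    simp only at this
    omega

variable {M}

lemma range_def {t : Fin s} (ϑ : M.LevelParam t) : range ϑ = fun k => ϑ (Sum.inr (Sum.inr k)) :=
  rfl

lemma range_mem_positiveRange {t : Fin s} {ϑ : M.LevelParam t} (hϑ : ϑ ∈ M.levelSpace t) :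
    range ϑ ∈ positiveRange d := fun k => hϑ (Sum.inr k)

lemma var_pos {t : Fin s} {ϑ : M.LevelParam t} (hϑ : ϑ ∈ M.levelSpace t) : 0 < var ϑ :=
  hϑ (Sum.inl ())

lemma R_posDef {t : Fin s} {φ : Fin d → ℝ} (hφ : φ ∈ positiveRange d) (hR : (M.R t φ).det ≠ 0) :
    (M.R t φ).PosDef := by
  have h : (M.R t φ).PosSemidef := (M.isCorrelation φ hφ).2 (M.design t) (M.design_subset t)
  exact h.posDef_iff_det_ne_zero.mpr hR

lemma R_isSymm {t : Fin s} {φ : Fin d → ℝ} (hφ : φ ∈ positiveRange d) : (M.R t φ).IsSymm := by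
  have h : (M.R t φ).PosSemidef := (M.isCorrelation φ hφ).2 (M.design t) (M.design_subset t)
  rw [IsSymm, ← conjTranspose_eq_transpose_of_trivial, h.isHermitian.eq]

lemma eventually_update_mem_positiveRange {φ : Fin d → ℝ} (hφ : φ ∈ positiveRange d) (k : Fin d) :
    ∀ᶠ u in nhds (φ k), Function.update φ k u ∈ positiveRange d := by
  filter_upwards [lt_mem_nhds (hφ k)] with u hu l
  by_cases h : l = k
  · subst h
    simpa using hu
  · simpa [h] using hφ l

/-- Symmetry of `R_t` is known only for positive ranges; these contain all nearby values of one
coordinate, which is enough for the derivatives to agree. -/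
lemma Rdot_isSymm {t : Fin s} {φ : Fin d → ℝ} (hφ : φ ∈ positiveRange d) (k : Fin d) :
    (M.Rdot t k φ).IsSymm := by
  ext x x'
  refine Filter.EventuallyEq.deriv_eq ?_
  filter_upwards [eventually_update_mem_positiveRange hφ k] with u hu
  exact (R_isSymm (M := M) (t := t) hu).apply x x'

variable (M)

/-- The covariance matrix `σ²_t R_t(φ_t)` of level `t`. -/
def cov (t : Fin s) (ϑ : M.LevelParam t) : Matrix (M.Run t) (M.Run t) ℝ :=
  var ϑ • M.R t (range ϑ)

/-- The partial derivatives of the mean vector `X_t b_t` in the parameters of level `t`. -/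
def meanDeriv (y : M.Output) (t : Fin s) (i : M.ParamIdx t) : M.Run t → ℝ :=
  Sum.elim (fun j => (M.X y t).col j) (fun _ => 0) i

/-- The partial derivatives of the covariance matrix `σ²_t R_t(φ_t)` in the parameters of
level `t`. -/
def covDeriv (t : Fin s) (ϑ : M.LevelParam t) (i : M.ParamIdx t) :
    Matrix (M.Run t) (M.Run t) ℝ :=
  Sum.elim (fun _ => 0)
    (Sum.elim (fun _ => M.R t (range ϑ)) (fun k => var ϑ • M.Rdot t k (range ϑ))) i

variable {M}

lemma covDeriv_isSymm {t : Fin s} {ϑ : M.LevelParam t} (hϑ : ϑ ∈ M.levelSpace t)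
    (i : M.ParamIdx t) : (M.covDeriv t ϑ i).IsSymm := by
  rcases i with j | _ | k
  · exact isSymm_zero
  · exact R_isSymm (range_mem_positiveRange hϑ)
  · exact (Rdot_isSymm (range_mem_positiveRange hϑ) k).smul _

lemma cov_posDef {t : Fin s} {ϑ : M.LevelParam t} (hϑ : ϑ ∈ M.levelSpace t)
    (hR : (M.R t (range ϑ)).det ≠ 0) : (M.cov t ϑ).PosDef :=
  (R_posDef (range_mem_positiveRange hϑ) hR).smul (var_pos hϑ)

lemma condDensity_pos {t : Fin s} {ϑ : M.LevelParam t} (hϑ : ϑ ∈ M.levelSpace t)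
    (hR : (M.R t (range ϑ)).det ≠ 0) (y : M.Output) : 0 < M.condDensity t ϑ y :=
  normalDensity_pos (cov_posDef hϑ hR).det_pos _

lemma hasDerivAt_mean (y : M.Output) {t : Fin s} (ϑ : M.LevelParam t) (i : M.ParamIdx t)
    (x : M.Run t) :
    HasDerivAt (fun u => ((M.X y t) *ᵥ (loc (Function.update ϑ i u))) x) (M.meanDeriv y t i x)
      (ϑ i) := by
  rcases i with j | j
  · have h : ∀ u, ((M.X y t) *ᵥ (loc (Function.update ϑ (Sum.inl j) u))) x =
        ∑ l, M.X y t x l * Function.update (loc ϑ) j u l := fun u => by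
      simp [mulVec, dotProduct, loc, Function.update_apply]
    simp only [h]
    have h2 : M.meanDeriv y t (Sum.inl j) x = ∑ l, M.X y t x l * (if l = j then 1 else 0) := by
      simp [meanDeriv]
    rw [h2]
    refine HasDerivAt.fun_sum fun l _ => HasDerivAt.const_mul _ ?_
    by_cases hl : l = j
    · subst hl
      simpa using hasDerivAt_id' _
    · simpa [hl] using hasDerivAt_const _ _
  · have h : ∀ u, loc (Function.update ϑ (Sum.inr j) u) = loc ϑ := fun u => by
      funext l
      simp [loc]
    simp only [h]
    exact hasDerivAt_const _ _

lemma hasDerivAt_cov {t : Fin s} {ϑ : M.LevelParam t}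
    (hdiff : ∀ x ∈ M.design t, ∀ x' ∈ M.design t, ∀ k : Fin d,
      DifferentiableAt ℝ (fun u => M.r x x' (Function.update (range ϑ) k u)) (range ϑ k))
    (i : M.ParamIdx t) (x x' : M.Run t) :
    HasDerivAt (fun u => M.cov t (Function.update ϑ i u) x x') (M.covDeriv t ϑ i x x') (ϑ i) := by
  rcases i with j | _ | k
  · have h : ∀ u, M.cov t (Function.update ϑ (Sum.inl j) u) = M.cov t ϑ := fun u => by
      simp [cov, var, range_def]
    simp only [h]
    exact hasDerivAt_const _ _
  · have h : ∀ u, M.cov t (Function.update ϑ (Sum.inr (Sum.inl ())) u) x x' =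
        u * M.R t (range ϑ) x x' := fun u => by
      simp [cov, var, range_def]
    simp only [h]
    simpa [covDeriv] using (hasDerivAt_id (ϑ (Sum.inr (Sum.inl ())))).mul_const
      (M.R t (range ϑ) x x')
  · have h : ∀ u, M.cov t (Function.update ϑ (Sum.inr (Sum.inr k)) u) x x' =
        var ϑ * M.r x x' (Function.update (range ϑ) k u) := fun u => by
      have : range (Function.update ϑ (Sum.inr (Sum.inr k)) u) =
          Function.update (range ϑ) k u := by
        funext l
        simp [range, Function.update_apply]
      rw [cov, this]
      simp [var, R]
    simp only [h]
    exact ((hdiff x x.2 x' x'.2 k).hasDerivAt).const_mul (var ϑ)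

/-- The score of a parameter of level `t`. -/
lemma hasDerivAt_logLikelihoodAlong
    (hR : ∀ t, ∀ φ ∈ positiveRange d, (M.R t φ).det ≠ 0)
    (hdiff : ∀ t, ∀ x ∈ M.design t, ∀ x' ∈ M.design t, ∀ φ ∈ positiveRange d, ∀ k : Fin d,
      DifferentiableAt ℝ (fun u => M.r x x' (Function.update φ k u)) (φ k))
    {θ : M.Param} (hθ : θ ∈ M.paramSpace) (t : Fin s) (i : M.ParamIdx t) (y : M.Output) :
    HasDerivAt (M.logLikelihoodAlong θ t i y)
      (normalScore (M.cov t (θ t)) (M.meanDeriv y t i) (M.covDeriv t (θ t) i)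
        (y t - M.X y t *ᵥ loc (θ t))) (θ t i) := by
  have hφ := range_mem_positiveRange (hθ t)
  have hcov := cov_posDef (hθ t) (hR t _ hφ)
  have hC := hasDerivAt_cov (fun x hx x' hx' k => hdiff t x hx x' hx' _ hφ k) i
  have hK : 0 < ∏ t' ∈ Finset.univ.erase t, M.condDensity t' (θ t') y :=
    Finset.prod_pos fun t' _ =>
      condDensity_pos (hθ t') (hR t' _ (range_mem_positiveRange (hθ t'))) y
  have hself : Function.update (θ t) i (θ t i) = θ t := Function.update_eq_self i (θ t)
  have hlog : M.logLikelihoodAlong θ t i y =ᶠ[nhds (θ t i)] fun u =>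
      Real.log (normalDensity (M.X y t *ᵥ loc (Function.update (θ t) i u))
        (M.cov t (Function.update (θ t) i u)) (y t)) +
      Real.log (∏ t' ∈ Finset.univ.erase t, M.condDensity t' (θ t') y) := by
    -- Continuity of the determinant keeps the density positive near `θ t i`, so the logarithm of
    -- the product splits there.
    have hdet := (HasDerivAt.matrix_det hC).continuousAt
    have hpos : 0 < (M.cov t (Function.update (θ t) i (θ t i))).det := by
      rw [hself]
      exact hcov.det_pos
    filter_upwards [hdet.eventually (lt_mem_nhds hpos)] with u hu
    rw [logLikelihoodAlong, likelihood, ← Finset.mul_prod_erase _ _ (Finset.mem_univ t),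
      Function.update_self, Finset.prod_congr rfl fun t' ht' => by
        rw [Function.update_of_ne (Finset.ne_of_mem_erase ht')],
      condDensity]
    exact Real.log_mul (normalDensity_pos hu _).ne' hK.ne'
  refine HasDerivAt.congr_of_eventuallyEq ?_ hlog
  have hmain := hasDerivAt_log_normalDensity (u₀ := θ t i)
    (m := fun u => M.X y t *ᵥ loc (Function.update (θ t) i u))
    (C := fun u => M.cov t (Function.update (θ t) i u))
    (hasDerivAt_mean y (θ t) i) hC (by rw [hself]; exact hcov) (y t)
  simp only [hself] at hmain
  exact hmain.add_const _

end CokrigingModel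
-- Fisher information of a level and the two priors
namespace CokrigingModel

open Matrix MeasureTheory

variable {d s : ℕ} {M : CokrigingModel d s}

lemma fisherIntegrand_eq
    (hR : ∀ t, ∀ φ ∈ positiveRange d, (M.R t φ).det ≠ 0)
    (hdiff : ∀ t, ∀ x ∈ M.design t, ∀ x' ∈ M.design t, ∀ φ ∈ positiveRange d, ∀ k : Fin d,
      DifferentiableAt ℝ (fun u => M.r x x' (Function.update φ k u)) (φ k))
    (y : M.Output) {θ : M.Param} (hθ : θ ∈ M.paramSpace) (t : Fin s) (i j : M.ParamIdx t) :
    M.fisherIntegrand y θ t i j = fun z =>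
      normalScore (M.cov t (θ t)) (M.meanDeriv y t i) (M.covDeriv t (θ t) i)
          (z - M.X y t *ᵥ loc (θ t)) *
        normalScore (M.cov t (θ t)) (M.meanDeriv y t j) (M.covDeriv t (θ t) j)
          (z - M.X y t *ᵥ loc (θ t)) *
        normalDensity (M.X y t *ᵥ loc (θ t)) (M.cov t (θ t)) z := by
  funext z
  have h : ∀ i, M.score θ t i (Function.update y t z) = _ := fun i =>
    (hasDerivAt_logLikelihoodAlong hR hdiff hθ t i (Function.update y t z)).deriv
  simp only [fisherIntegrand, h, condDensity, meanDeriv, X_update_self, Function.update_self]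
  rfl

lemma fisherWellDefined
    (hR : ∀ t, ∀ φ ∈ positiveRange d, (M.R t φ).det ≠ 0)
    (hdiff : ∀ t, ∀ x ∈ M.design t, ∀ x' ∈ M.design t, ∀ φ ∈ positiveRange d, ∀ k : Fin d,
      DifferentiableAt ℝ (fun u => M.r x x' (Function.update φ k u)) (φ k))
    (y : M.Output) : M.FisherWellDefined y := by
  intro θ hθ t
  refine ⟨fun i z => (hasDerivAt_logLikelihoodAlong hR hdiff hθ t i _).differentiableAt,
    fun i j => ?_⟩
  rw [fisherIntegrand_eq hR hdiff y hθ]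
  exact (integral_normalScore_mul_normalScore _
    (cov_posDef (hθ t) (hR t _ (range_mem_positiveRange (hθ t)))) _ _ _
    (covDeriv_isSymm (hθ t) j)).1

lemma fisher_apply
    (hR : ∀ t, ∀ φ ∈ positiveRange d, (M.R t φ).det ≠ 0)
    (hdiff : ∀ t, ∀ x ∈ M.design t, ∀ x' ∈ M.design t, ∀ φ ∈ positiveRange d, ∀ k : Fin d,
      DifferentiableAt ℝ (fun u => M.r x x' (Function.update φ k u)) (φ k))
    (y : M.Output) {θ : M.Param} (hθ : θ ∈ M.paramSpace) (t : Fin s) (i j : M.ParamIdx t) :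
    M.fisher y θ t i j = M.meanDeriv y t i ⬝ᵥ ((M.cov t (θ t))⁻¹ *ᵥ M.meanDeriv y t j) +
      1 / 2 * ((M.cov t (θ t))⁻¹ * M.covDeriv t (θ t) i *
        ((M.cov t (θ t))⁻¹ * M.covDeriv t (θ t) j)).trace := by
  rw [fisher, of_apply, fisherIntegrand_eq hR hdiff y hθ]
  exact (integral_normalScore_mul_normalScore _
    (cov_posDef (hθ t) (hR t _ (range_mem_positiveRange (hθ t)))) _ _ _
    (covDeriv_isSymm (hθ t) j)).2

lemma cov_inv {t : Fin s} {ϑ : M.LevelParam t} (hϑ : ϑ ∈ M.levelSpace t)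
    (hR : (M.R t (range ϑ)).det ≠ 0) : (M.cov t ϑ)⁻¹ = (var ϑ)⁻¹ • (M.R t (range ϑ))⁻¹ := by
  have := (var_pos hϑ).ne'
  refine inv_eq_right_inv ?_
  rw [cov, smul_mul_smul_comm, mul_inv_cancel₀ this, one_smul,
    mul_nonsing_inv _ (isUnit_iff_ne_zero.mpr hR)]

/-- The Fisher information of a level is block diagonal. -/
lemma fisher_eq_fromBlocks
    (hR : ∀ t, ∀ φ ∈ positiveRange d, (M.R t φ).det ≠ 0)
    (hdiff : ∀ t, ∀ x ∈ M.design t, ∀ x' ∈ M.design t, ∀ φ ∈ positiveRange d, ∀ k : Fin d,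
      DifferentiableAt ℝ (fun u => M.r x x' (Function.update φ k u)) (φ k))
    (y : M.Output) {θ : M.Param} (hθ : θ ∈ M.paramSpace) (t : Fin s) :
    M.fisher y θ t =
      fromBlocks ((var (θ t))⁻¹ • M.XRX y t (range (θ t))) 0 0
        ((1 / 2 : ℝ) • (diagonal (Sum.elim (fun _ => (var (θ t))⁻¹) (fun _ => 1)) *
          M.IJ t (range (θ t)) * diagonal (Sum.elim (fun _ => (var (θ t))⁻¹) (fun _ => 1)))) := by
  have hφ := range_mem_positiveRange (hθ t)
  have hv := (var_pos (hθ t)).ne'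
  have hu := isUnit_iff_ne_zero.mpr (hR t _ hφ)
  -- Cyclicity of the trace converts `R⁻¹ Ṙ`, produced by the normal family, into `U = Ṙ R⁻¹`.
  have hU : ∀ k, ((M.R t (range (θ t)))⁻¹ * M.Rdot t k (range (θ t))).trace =
      (M.U t k (range (θ t))).trace := fun k => by rw [U, trace_mul_comm]
  have hUU : ∀ k l, ((M.R t (range (θ t)))⁻¹ * M.Rdot t k (range (θ t)) *
      ((M.R t (range (θ t)))⁻¹ * M.Rdot t l (range (θ t)))).trace =
      (M.U t k (range (θ t)) * M.U t l (range (θ t))).trace := fun k l => by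
    rw [U, U, ← Matrix.mul_assoc (M.Rdot t k _ * _), trace_mul_comm _ (M.R t _)⁻¹]
    simp only [Matrix.mul_assoc]
  ext i j
  rw [fisher_apply hR hdiff y hθ, cov_inv (hθ t) (hR t _ hφ)]
  rcases i with i | _ | k <;> rcases j with j | _ | l
  · simp [meanDeriv, covDeriv, smul_mulVec, XRX, Matrix.mul_assoc]
    left
    rfl
  · simp [meanDeriv, covDeriv]
  · simp [meanDeriv, covDeriv]
  · simp [meanDeriv, covDeriv]
  · simp [meanDeriv, covDeriv, IJ, nonsing_inv_mul _ hu, n, diagonal_mul]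
    ring
  · simp [meanDeriv, covDeriv, IJ, nonsing_inv_mul _ hu, hU, hv]
  · simp [meanDeriv, covDeriv]
  · simp [meanDeriv, covDeriv, IJ, nonsing_inv_mul _ hu, hU, hv]
    ring
  · simp [meanDeriv, covDeriv, IJ, hUU, hv]

lemma sqrt_det_fisherLoc
    (hR : ∀ t, ∀ φ ∈ positiveRange d, (M.R t φ).det ≠ 0)
    (hdiff : ∀ t, ∀ x ∈ M.design t, ∀ x' ∈ M.design t, ∀ φ ∈ positiveRange d, ∀ k : Fin d,
      DifferentiableAt ℝ (fun u => M.r x x' (Function.update φ k u)) (φ k))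
    (y : M.Output) {θ : M.Param} (hθ : θ ∈ M.paramSpace) (t : Fin s) :
    Real.sqrt (M.fisherLoc y θ t).det =
      Real.sqrt (M.XRX y t (range (θ t))).det / var (θ t) ^ ((M.q t : ℝ) / 2) := by
  have hv := var_pos (hθ t)
  rw [fisherLoc, fisher_eq_fromBlocks hR hdiff y hθ, toBlocks_fromBlocks₁₁, det_smul, inv_pow,
    Real.sqrt_mul (by positivity), Real.sqrt_inv, div_eq_inv_mul, Real.sqrt_eq_rpow (_ ^ _),
    ← Real.rpow_natCast, ← Real.rpow_mul hv.le, q, mul_one_div]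

lemma sqrt_det_fisherScale
    (hR : ∀ t, ∀ φ ∈ positiveRange d, (M.R t φ).det ≠ 0)
    (hdiff : ∀ t, ∀ x ∈ M.design t, ∀ x' ∈ M.design t, ∀ φ ∈ positiveRange d, ∀ k : Fin d,
      DifferentiableAt ℝ (fun u => M.r x x' (Function.update φ k u)) (φ k))
    (y : M.Output) {θ : M.Param} (hθ : θ ∈ M.paramSpace) (t : Fin s) :
    Real.sqrt (M.fisherScale y θ t).det =
      Real.sqrt ((1 / 2) ^ (1 + d)) * (Real.sqrt (M.IJ t (range (θ t))).det / var (θ t)) := by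
  have hv := var_pos (hθ t)
  -- The block has size `1 + d`, which gives the power of `1 / 2`; each of the two diagonal factors
  -- contributes one `σ_t⁻²`.
  have h : (M.fisherScale y θ t).det =
      (1 / 2) ^ (1 + d) * ((var (θ t))⁻¹ ^ 2 * (M.IJ t (range (θ t))).det) := by
    rw [fisherScale, fisher_eq_fromBlocks hR hdiff y hθ, toBlocks_fromBlocks₂₂, det_smul, det_mul,
      det_mul, det_diagonal]
    simp
    ring
  rw [h, Real.sqrt_mul (by positivity), Real.sqrt_mul (by positivity),
    Real.sqrt_sq (by positivity), div_eq_inv_mul (Real.sqrt _)]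

lemma sqrt_det_fisher
    (hR : ∀ t, ∀ φ ∈ positiveRange d, (M.R t φ).det ≠ 0)
    (hdiff : ∀ t, ∀ x ∈ M.design t, ∀ x' ∈ M.design t, ∀ φ ∈ positiveRange d, ∀ k : Fin d,
      DifferentiableAt ℝ (fun u => M.r x x' (Function.update φ k u)) (φ k))
    (y : M.Output) {θ : M.Param} (hθ : θ ∈ M.paramSpace) (t : Fin s)
    (hX : 0 < (M.XRX y t (range (θ t))).det) :
    Real.sqrt (M.fisher y θ t).det =
      Real.sqrt ((1 / 2) ^ (1 + d)) * (Real.sqrt (M.IJ t (range (θ t))).det *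
        Real.sqrt (M.XRX y t (range (θ t))).det / var (θ t) ^ (1 + (M.q t : ℝ) / 2)) := by
  have hv := var_pos (hθ t)
  have h : (M.fisher y θ t).det = (M.fisherLoc y θ t).det * (M.fisherScale y θ t).det := by
    rw [fisherLoc, fisherScale, fisher_eq_fromBlocks hR hdiff y hθ, toBlocks_fromBlocks₁₁,
      toBlocks_fromBlocks₂₂, det_fromBlocks_zero₂₁]
  have hpos : 0 ≤ (M.fisherLoc y θ t).det := by
    rw [fisherLoc, fisher_eq_fromBlocks hR hdiff y hθ, toBlocks_fromBlocks₁₁, det_smul]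
    positivity
  rw [h, Real.sqrt_mul hpos, sqrt_det_fisherLoc hR hdiff y hθ, sqrt_det_fisherScale hR hdiff y hθ,
    Real.rpow_add hv, Real.rpow_one]
  ring

/-- Full column rank transfers positive definiteness from `R_t⁻¹`. Strict positivity matters because
the root of this determinant enters a constant of proportionality for the first kind. -/
lemma det_XRX_pos {y : M.Output} {t : Fin s} (hX : LinearIndependent ℝ (M.X y t).col)
    {φ : Fin d → ℝ} (hφ : φ ∈ positiveRange d) (hR : (M.R t φ).det ≠ 0) :
    0 < (M.XRX y t φ).det := by
  have h := (R_posDef hφ hR).inv.conjTranspose_mul_mul_same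
    (B := M.X y t) (mulVec_injective_iff.mpr hX)
  rw [conjTranspose_eq_transpose_of_trivial] at h
  exact h.det_pos

-- A base point at which the other parameters can be frozen: one such choice already determines each
-- Jeffreys-rule factor up to a constant.
variable (M) in
lemma one_mem_paramSpace : (fun _ _ => 1 : M.Param) ∈ M.paramSpace := fun _ _ => one_pos

lemma update_mem_paramSpace {θ : M.Param} (hθ : θ ∈ M.paramSpace) {t : Fin s}
    {ϑ : M.LevelParam t} (hϑ : ϑ ∈ M.levelSpace t) :
    Function.update θ t ϑ ∈ M.paramSpace := by
  intro t'
  by_cases h : t' = t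
  · subst h
    simpa using hϑ
  · simpa [h] using hθ t'

lemma isIndepJeffreysOne_iff
    (hR : ∀ t, ∀ φ ∈ positiveRange d, (M.R t φ).det ≠ 0)
    (hdiff : ∀ t, ∀ x ∈ M.design t, ∀ x' ∈ M.design t, ∀ φ ∈ positiveRange d, ∀ k : Fin d,
      DifferentiableAt ℝ (fun u => M.r x x' (Function.update φ k u)) (φ k))
    {y : M.Output} (hX : ∀ t, LinearIndependent ℝ (M.X y t).col) (π : M.Param → ℝ) :
    M.IsIndepJeffreysOne y π ↔ ProportionalOn M.paramSpace π
      (fun θ => ∏ t, Real.sqrt (M.IJ t (range (θ t))).det / var (θ t)) := by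
  -- With `(σ²_t, φ_t)` frozen, the location block does not depend on `b`, so the Jeffreys-rule
  -- prior is flat.
  have hloc : ∀ t, ∀ θ ∈ M.paramSpace, ProportionalOn Set.univ (fun b =>
      Real.sqrt (M.fisherLoc y (Function.update θ t (Sum.elim b (scale (θ t)))) t).det)
      (fun _ => 1) := by
    intro t θ hθ
    have hφ := range_mem_positiveRange (hθ t)
    refine ⟨Real.sqrt (M.XRX y t (range (θ t))).det / var (θ t) ^ ((M.q t : ℝ) / 2),
      div_pos (Real.sqrt_pos.mpr (det_XRX_pos (hX t) hφ (hR t _ hφ)))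
        (Real.rpow_pos_of_pos (var_pos (hθ t)) _), fun b _ => ?_⟩
    have hmem : Function.update θ t (Sum.elim b (scale (θ t))) ∈ M.paramSpace :=
      update_mem_paramSpace hθ (hθ t)
    beta_reduce
    rw [sqrt_det_fisherLoc hR hdiff y hmem, Function.update_self, mul_one]
    rfl
  have hscale : ∀ t, ∀ θ ∈ M.paramSpace, ProportionalOn (scaleSpace d) (fun ψ =>
      Real.sqrt (M.fisherScale y (Function.update θ t (Sum.elim (loc (θ t)) ψ)) t).det)
      (fun ψ => Real.sqrt (M.IJ t (fun k => ψ (Sum.inr k))).det / ψ (Sum.inl ())) := by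
    intro t θ hθ
    refine ⟨Real.sqrt ((1 / 2) ^ (1 + d)), by positivity, fun ψ hψ => ?_⟩
    have hmem : Function.update θ t (Sum.elim (loc (θ t)) ψ) ∈ M.paramSpace :=
      update_mem_paramSpace hθ hψ
    beta_reduce
    rw [sqrt_det_fisherScale hR hdiff y hmem, Function.update_self]
    rfl
  constructor
  · rintro ⟨f, g, hf, hg, hπ⟩
    refine hπ.trans (ProportionalOn.prod fun t => ?_)
    have hf' := ((hf t _ (one_mem_paramSpace M)).trans (hloc t _ (one_mem_paramSpace M))).comp
      (T := M.paramSpace) (e := fun θ => loc (θ t)) fun _ _ => Set.mem_univ _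
    have hg' := ((hg t _ (one_mem_paramSpace M)).trans (hscale t _ (one_mem_paramSpace M))).comp
      (T := M.paramSpace) (e := fun θ => scale (θ t)) fun θ hθ => hθ t
    have := hf'.mul hg'
    simp only [one_mul] at this
    exact this
  · intro hπ
    refine ⟨fun _ _ => 1, fun t ψ => Real.sqrt (M.IJ t (fun k => ψ (Sum.inr k))).det /
      ψ (Sum.inl ()), fun t θ hθ => (hloc t θ hθ).symm, fun t θ hθ => (hscale t θ hθ).symm, ?_⟩
    simp only [one_mul]
    exact hπ

lemma isIndepJeffreysTwo_iff
    (hR : ∀ t, ∀ φ ∈ positiveRange d, (M.R t φ).det ≠ 0)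
    (hdiff : ∀ t, ∀ x ∈ M.design t, ∀ x' ∈ M.design t, ∀ φ ∈ positiveRange d, ∀ k : Fin d,
      DifferentiableAt ℝ (fun u => M.r x x' (Function.update φ k u)) (φ k))
    {y : M.Output} (hX : ∀ t, LinearIndependent ℝ (M.X y t).col) (π : M.Param → ℝ) :
    M.IsIndepJeffreysTwo y π ↔ ProportionalOn M.paramSpace π
      (fun θ => ∏ t, Real.sqrt (M.IJ t (range (θ t))).det *
        Real.sqrt (M.XRX y t (range (θ t))).det / var (θ t) ^ (1 + (M.q t : ℝ) / 2)) := by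
  have hlevel : ∀ t, ∀ θ ∈ M.paramSpace, ProportionalOn (M.levelSpace t) (fun ϑ =>
      Real.sqrt (M.fisher y (Function.update θ t ϑ) t).det)
      (fun ϑ => Real.sqrt (M.IJ t (range ϑ)).det *
        Real.sqrt (M.XRX y t (range ϑ)).det / var ϑ ^ (1 + (M.q t : ℝ) / 2)) := by
    intro t θ hθ
    refine ⟨Real.sqrt ((1 / 2) ^ (1 + d)), by positivity, fun ϑ hϑ => ?_⟩
    have hφ := range_mem_positiveRange hϑ
    have hpos := det_XRX_pos (hX t) hφ (hR t _ hφ)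
    beta_reduce
    rw [sqrt_det_fisher hR hdiff y (update_mem_paramSpace hθ hϑ) t
      (by rwa [Function.update_self]), Function.update_self]
  constructor
  · rintro ⟨f, hf, hπ⟩
    exact hπ.trans (ProportionalOn.prod fun t =>
      ((hf t _ (one_mem_paramSpace M)).trans (hlevel t _ (one_mem_paramSpace M))).comp
        (T := M.paramSpace) (e := fun θ => θ t) fun θ hθ => hθ t)
  · intro hπ
    exact ⟨fun t ϑ => _, fun t θ hθ => (hlevel t θ hθ).symm, hπ⟩

/-- On the parameter space `π₀` is evaluated only at positive ranges, so its constant of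
proportionality to `π₁` can be merged into that of `π`. -/
lemma exists_hasGeneralForm_iff (π : M.Param → ℝ) (a : Fin s → ℝ)
    (π₁ : (Fin s → Fin d → ℝ) → ℝ) :
    (∃ π₀ : (Fin s → Fin d → ℝ) → ℝ, M.HasGeneralForm π a π₀ ∧
      ProportionalOn {φ | ∀ t, φ t ∈ positiveRange d} π₀ π₁) ↔ M.HasGeneralForm π a π₁ := by
  refine ⟨fun ⟨π₀, h, h₀⟩ => h.trans ?_, fun h => ⟨π₁, h, ProportionalOn.refl _ _⟩⟩
  have := (h₀.comp (T := M.paramSpace) (e := fun θ t => range (θ t))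
    fun θ hθ t => range_mem_positiveRange (hθ t)).mul
      (ProportionalOn.refl _ fun θ : M.Param => (∏ t, var (θ t) ^ a t)⁻¹)
  simpa only [← div_eq_mul_inv] using this

end CokrigingModel
end

theorem mainTheorem6 {d s : ℕ} (M : CokrigingModel d s) (y : M.Output)
    (hR : ∀ t, ∀ φ ∈ positiveRange d, (M.R t φ).det ≠ 0)
    (hdiff : ∀ t, ∀ x ∈ M.design t, ∀ x' ∈ M.design t, ∀ φ ∈ positiveRange d, ∀ k : Fin d,
      DifferentiableAt ℝ (fun u => M.r x x' (Function.update φ k u)) (φ k))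
    (hX : ∀ t, LinearIndependent ℝ (M.X y t).col) :
    M.FisherWellDefined y ∧
    (∀ π : M.Param → ℝ, M.IsIndepJeffreysOne y π ↔
      ∃ π₀ : (Fin s → Fin d → ℝ) → ℝ,
        M.HasGeneralForm π (fun _ => 1) π₀ ∧
        ProportionalOn {φ | ∀ t, φ t ∈ positiveRange d} π₀
          (fun φ => ∏ t, Real.sqrt (M.IJ t (φ t)).det)) ∧
    (∀ π : M.Param → ℝ, M.IsIndepJeffreysTwo y π ↔
      ∃ π₀ : (Fin s → Fin d → ℝ) → ℝ,
        M.HasGeneralForm π (fun t => 1 + (M.q t : ℝ) / 2) π₀ ∧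
        ProportionalOn {φ | ∀ t, φ t ∈ positiveRange d} π₀
          (fun φ => (∏ t, Real.sqrt (M.IJ t (φ t)).det) *
            ∏ t, Real.sqrt (M.XRX y t (φ t)).det)) := by
  refine ⟨CokrigingModel.fisherWellDefined hR hdiff y, fun π => ?_, fun π => ?_⟩
  · rw [CokrigingModel.exists_hasGeneralForm_iff,
      CokrigingModel.isIndepJeffreysOne_iff hR hdiff hX, CokrigingModel.HasGeneralForm]
    simp only [Real.rpow_one, Finset.prod_div_distrib]
  · rw [CokrigingModel.exists_hasGeneralForm_iff,
      CokrigingModel.isIndepJeffreysTwo_iff hR hdiff hX, CokrigingModel.HasGeneralForm]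
    simp only [Finset.prod_div_distrib, Finset.prod_mul_distrib]
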